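/- Let $\mathbb F$ be a field and $V$ a vector space over $\mathbb F$ of finite positive dimension. For a diagonalizable $A\in\mathrm{End}(V)$ (that is, $V$ is spanned by the eigenspaces of $A$) and an eigenvalue $\theta$ of $A$, the corresponding primitive idempotent of $A$ is the element of $\mathrm{End}(V)$ that acts as the identity on the $\theta$-eigenspace of $A$ and as zero on all other eigenspaces of $A$. Let $d\ge 0$ be an integer. A mock tridiagonal (MTD) system on $V$ is a sequence $\Phi=(A;\{E_i\}_{i=0}^d;A^*;\{E^*_i\}_{i=0}^d)$ of elements of $\mathrm{End}(V)$ such that: $A$ and $A^*$ are diagonalizable (the star does not denote an adjoint); $\{E_i\}_{i=0}^d$ is an ordering of the primitive idempotents of $A$ with $E_iA^*E_j=0$ if $|i-j|>1$; $\{E^*_i\}_{i=0}^d$ is an ordering of the primitive idempotents of $A^*$ with $E^*_iAE^*_j=0$ if $|i-j|>1$ $(0\le i,j\le d)$; and $E^*_0E_0E^*_0\neq0$, $E^*_0E_dE^*_0\ne 0$. Let $\theta_i$ (resp. $\theta^*_i$) be the eigenvalue of $A$ (resp. $A^*$) with eigenspace $E_iV$ (resp. $E^*_iV$). The system $\Phi$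 is called sharp if $\dim E^*_0V=1$; in this case there are unique scalars $\zeta_i\in\mathbb F$ $(0\le i\le d)$ such that $$E^*_0\,(A-\theta_0I)(A-\theta_1I)\cdots(A-\theta_{i-1}I)\,E^*_0=\frac{\zeta_i\,E^*_0}{(\theta^*_0-\theta^*_1)(\theta^*_0-\theta^*_2)\cdots(\theta^*_0-\theta^*_i)},$$ and $(\{\theta_i\}_{i=0}^d;\{\theta^*_i\}_{i=0}^d;\{\zeta_i\}_{i=0}^d)$ is called the parameter array of $\Phi$. For $0\le i\le d$ put $$\eta_i(\lambda)=(\lambda-\theta_d)(\lambda-\theta_{d-1})\cdots(\lambda-\theta_{d-i+1}),\qquad \eta^*_i(\lambda)=(\lambda-\theta^*_d)(\lambda-\theta^*_{d-1})\cdots(\lambda-\theta^*_{d-i+1}).$$ Let $(\{\theta_i\}_{i=0}^d;\{\theta^*_i\}_{i=0}^d;\{\zeta_i\}_{i=0}^d)$ be the parameter array of a sharp MTD system on $V$. Then: (i) $\theta_i\ne\theta_j$ and $\theta^*_i\neq\theta^*_j$ if $i\neq j$ $(0\le i,j\le d)$. (ii) $\zeta_0=1$, $\zeta_d\neq0$,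 and $\displaystyle\sum_{i=0}^d\eta_{d-i}(\theta_0)\,\eta^*_{d-i}(\theta^*_0)\,\zeta_i\neq0$. (iii) The expressions $$\frac{\theta_{i-2}-\theta_{i+1}}{\theta_{i-1}-\theta_i},\qquad \frac{\theta^*_{i-2}-\theta^*_{i+1}}{\theta^*_{i-1}-\theta^*_i}$$ are equal and independent of $i$ for $2\le i\le d-1$. -/

import Mathlib

open Polynomial

/-- The space is spanned by the eigenspaces of `A`. -/
def IsDiagonalizableEnd {F V : Type*} [Field F] [AddCommGroup V] [Module F V]
    (A : Module.End F V) : Prop :=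
  (⨆ μ : F, A.eigenspace μ) = ⊤

/-- `P` is the primitive idempotent of (the diagonalizable map) `A` for the eigenvalue `μ`:
the identity on the eigenspace of `μ`, zero on every other eigenspace. -/
def IsPrimitiveIdempotentFor {F V : Type*} [Field F] [AddCommGroup V] [Module F V]
    (A : Module.End F V) (μ : F) (P : Module.End F V) : Prop :=
  A.HasEigenvalue μ ∧ (∀ v ∈ A.eigenspace μ, P v = v) ∧
    ∀ ν : F, ν ≠ μ → ∀ v ∈ A.eigenspace ν, P v = 0

/-- `E 0, ..., E d` lists every primitive idempotent of `A` exactly once. -/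
def IsPrimitiveIdempotentOrdering {F V : Type*} [Field F] [AddCommGroup V] [Module F V]
    {d : ℕ} (A : Module.End F V) (E : Fin (d + 1) → Module.End F V) : Prop :=
  Function.Injective E ∧
    ∀ P : Module.End F V, P ∈ Set.range E ↔ ∃ μ : F, IsPrimitiveIdempotentFor A μ P

/-- A mock tridiagonal system `(A; E 0, ..., E d; As; Es 0, ..., Es d)` on `V`. The pair `As`, `Es`
is the "starred" pair; no adjoint is involved. -/
structure MTDSystem (F V : Type*) [Field F] [AddCommGroup V] [Module F V] (d : ℕ) where
  A : Module.End F V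
  E : Fin (d + 1) → Module.End F V
  As : Module.End F V
  Es : Fin (d + 1) → Module.End F V
  diag : IsDiagonalizableEnd A
  diag_star : IsDiagonalizableEnd As
  ordering : IsPrimitiveIdempotentOrdering A E
  tridiag : ∀ i j : Fin (d + 1), 1 < |(i : ℤ) - (j : ℤ)| → E i * As * E j = 0
  ordering_star : IsPrimitiveIdempotentOrdering As Es
  tridiag_star : ∀ i j : Fin (d + 1), 1 < |(i : ℤ) - (j : ℤ)| → Es i * A * Es j = 0
  first_ne_zero : Es 0 * E 0 * Es 0 ≠ 0
  last_ne_zero : Es 0 * E (Fin.last d) * Es 0 ≠ 0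

/-- `θ i` is the eigenvalue of `A` whose eigenspace is `E i V`. -/
def IsEigenvalueSequence {F V : Type*} [Field F] [AddCommGroup V] [Module F V] {d : ℕ}
    (A : Module.End F V) (E : Fin (d + 1) → Module.End F V) (θ : Fin (d + 1) → F) : Prop :=
  ∀ i, A.HasEigenvalue (θ i) ∧ LinearMap.range (E i) = A.eigenspace (θ i)

/-- `τ_i = (X - θ_0)(X - θ_1) ⋯ (X - θ_{i-1})`. -/
noncomputable def tauPoly {F : Type*} [Field F] {d : ℕ} (θ : Fin (d + 1) → F)
    (i : Fin (d + 1)) : F[X] :=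
  ∏ j ∈ Finset.Iio i, (X - C (θ j))

/-- `η_i = (X - θ_d)(X - θ_{d-1}) ⋯ (X - θ_{d-i+1})`; here `Fin.rev j` is `d - j`. -/
noncomputable def etaPoly {F : Type*} [Field F] {d : ℕ} (θ : Fin (d + 1) → F)
    (i : Fin (d + 1)) : F[X] :=
  ∏ j ∈ Finset.Iio i, (X - C (θ (Fin.rev j)))

namespace MTDSystem

/-- `Es 0 V` has dimension one. -/
def IsSharp {F V : Type*} [Field F] [AddCommGroup V] [Module F V] {d : ℕ}
    (Φ : MTDSystem F V d) : Prop :=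
  Module.finrank F (LinearMap.range (Φ.Es 0)) = 1

/-- `ζ` is the split sequence of the (sharp) system `Φ` with eigenvalue sequence `θ` and dual
eigenvalue sequence `θs`. -/
def IsSplitSequence {F V : Type*} [Field F] [AddCommGroup V] [Module F V] {d : ℕ}
    (Φ : MTDSystem F V d) (θ θs ζ : Fin (d + 1) → F) : Prop :=
  ∀ i, Φ.Es 0 * aeval Φ.A (tauPoly θ i) * Φ.Es 0 =
    (ζ i / ∏ h ∈ Finset.Ioc 0 i, (θs 0 - θs h)) • Φ.Es 0

/-- `(θ; θs; ζ)` is the parameter array of the (sharp) system `Φ`. -/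
def IsParameterArray {F V : Type*} [Field F] [AddCommGroup V] [Module F V] {d : ℕ}
    (Φ : MTDSystem F V d) (θ θs ζ : Fin (d + 1) → F) : Prop :=
  IsEigenvalueSequence Φ.A Φ.E θ ∧ IsEigenvalueSequence Φ.As Φ.Es θs ∧
    Φ.IsSplitSequence θ θs ζ

end MTDSystem

/-! Parts (i) and (ii) are spectral calculus: the θ_i are distinct because the E_i are, and τ_d(A),
η_d(A) are nonzero multiples of E_d, E_0, so the two conditions on ζ restate E*_0 E_d E*_0 ≠ 0 and
E*_0 E_0 E*_0 ≠ 0.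

For (iii), let u span E*_0 V. The crucial fact is E*_n τ_n(A) u ≠ 0 for all n
(`Es_tauPoly_ne_zero`), so E*_n detects the leading coefficient of a polynomial of degree n in A
applied to u (`Es_aeval_eq`). Since A* is tridiagonal for the E_i, interpolation gives p with A²A*A
- AA*A² = [p(A), A*] (`exists_commutator_polynomial`). The left side raises the E*-flag by at most
3, which forces deg p ≤ 3. Comparing top components on A^m u gives c(θ*_m - θ*_{m+3}) = θ*_{m+1} -
θ*_{m+2}, with c the cubic coefficient of p (`exists_cubic_recurrence`). The interpolation
conditions on p give the same relation for θ (`coeff_three_mul_sub`), so both ratios equal 1/c. -/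

/-- A family of orthogonal idempotents summing to one that diagonalizes `A`, with pairwise distinct
eigenvalues `θ i`. -/
structure IsSpectralResolution {F V : Type*} [Field F] [AddCommGroup V] [Module F V] {d : ℕ}
    (A : Module.End F V) (E : Fin (d + 1) → Module.End F V) (θ : Fin (d + 1) → F) : Prop where
  injective : Function.Injective θ
  sum_eq_one : ∑ i, E i = 1
  map_apply : ∀ i v, A (E i v) = θ i • E i v
  apply_map : ∀ i v, E i (A v) = θ i • E i v
  apply_self : ∀ i v, E i (E i v) = E i v
  apply_of_ne : ∀ i j v, i ≠ j → E i (E j v) = 0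

/-! ### Spectral resolution of a diagonalizable map. -/

section Diagonalizable

variable {F V : Type*} [Field F] [AddCommGroup V] [Module F V] {d : ℕ}
  {A : Module.End F V} {E : Fin (d + 1) → Module.End F V} {θ : Fin (d + 1) → F}

lemma IsDiagonalizableEnd.hom_ext (hA : IsDiagonalizableEnd A) {f g : Module.End F V}
    (h : ∀ μ : F, ∀ v ∈ A.eigenspace μ, f v = g v) : f = g := by
  ext v
  have hv : v ∈ ⨆ μ : F, A.eigenspace μ := by
    rw [show (⨆ μ : F, A.eigenspace μ) = ⊤ from hA]; trivial
  have hle : (⨆ μ : F, A.eigenspace μ) ≤ LinearMap.eqLocus f g :=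
    iSup_le fun μ w hw => h μ w hw
  exact hle hv

lemma IsPrimitiveIdempotentFor.eq (hA : IsDiagonalizableEnd A) {μ : F} {P Q : Module.End F V}
    (hP : IsPrimitiveIdempotentFor A μ P) (hQ : IsPrimitiveIdempotentFor A μ Q) : P = Q := by
  refine hA.hom_ext fun ν v hv => ?_
  by_cases h : ν = μ
  · subst h; rw [hP.2.1 v hv, hQ.2.1 v hv]
  · rw [hP.2.2 ν h v hv, hQ.2.2 ν h v hv]

lemma IsEigenvalueSequence.isPrimitiveIdempotentFor (hE : IsPrimitiveIdempotentOrdering A E)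
    (hθ : IsEigenvalueSequence A E θ) (i : Fin (d + 1)) :
    IsPrimitiveIdempotentFor A (θ i) (E i) := by
  obtain ⟨μ, hμ⟩ := (hE.2 (E i)).1 ⟨i, rfl⟩
  obtain ⟨v, hv⟩ := hμ.1.exists_hasEigenvector
  have hv' : v ∈ A.eigenspace (θ i) := by
    rw [← (hθ i).2]
    exact ⟨v, hμ.2.1 v hv.1⟩
  have h1 : A v = μ • v := Module.End.mem_eigenspace_iff.1 hv.1
  have h2 : A v = θ i • v := Module.End.mem_eigenspace_iff.1 hv'
  have h3 : μ = θ i := smul_left_injective F hv.2 (h1.symm.trans h2)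
  exact h3 ▸ hμ

/-- Eigenspaces are independent and span, so the idempotent is the projection along the sum of the
other eigenspaces. -/
lemma IsDiagonalizableEnd.exists_isPrimitiveIdempotentFor (hA : IsDiagonalizableEnd A) {μ : F}
    (hμ : A.HasEigenvalue μ) : ∃ P, IsPrimitiveIdempotentFor A μ P := by
  have hdisj : Disjoint (A.eigenspace μ) (⨆ ν ≠ μ, A.eigenspace ν) :=
    A.eigenspaces_iSupIndep μ
  have hcod : Codisjoint (A.eigenspace μ) (⨆ ν ≠ μ, A.eigenspace ν) := by
    rw [codisjoint_iff, eq_top_iff, ← (show (⨆ ν : F, A.eigenspace ν) = ⊤ from hA)]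
    refine iSup_le fun ν => ?_
    by_cases h : ν = μ
    · subst h; exact le_sup_left
    · exact le_sup_of_le_right (le_iSup₂_of_le ν h le_rfl)
  have hc : IsCompl (A.eigenspace μ) (⨆ ν ≠ μ, A.eigenspace ν) := ⟨hdisj, hcod⟩
  refine ⟨Submodule.projection _ _ hc, hμ, fun v hv => ?_, fun ν hν v hv => ?_⟩
  · exact Submodule.projection_apply_left hc ⟨v, hv⟩
  · rw [Submodule.projection_apply_eq_zero_iff]
    exact (le_iSup₂_of_le (f := fun ν (_ : ν ≠ μ) => A.eigenspace ν) ν hν le_rfl) hv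

lemma IsEigenvalueSequence.isSpectralResolution (hA : IsDiagonalizableEnd A)
    (hE : IsPrimitiveIdempotentOrdering A E) (hθ : IsEigenvalueSequence A E θ) :
    IsSpectralResolution A E θ := by
  have hP := hθ.isPrimitiveIdempotentFor hE
  have hinj : Function.Injective θ := fun i j hij =>
    hE.1 ((hP i).eq hA (hij ▸ hP j))
  have hmem : ∀ i v, E i v ∈ A.eigenspace (θ i) := fun i v => (hθ i).2 ▸ ⟨v, rfl⟩
  refine ⟨hinj, ?_, fun i v => Module.End.mem_eigenspace_iff.1 (hmem i v), fun i v => ?_,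
    fun i v => (hP i).2.1 _ (hmem i v),
    fun i j v hij => (hP i).2.2 (θ j) (fun h => hij (hinj h.symm)) _ (hmem j v)⟩
  · refine hA.hom_ext fun μ v hv => ?_
    by_cases h0 : v = 0
    · simp [h0]
    have hμ : A.HasEigenvalue μ := Module.End.hasEigenvalue_of_hasEigenvector ⟨hv, h0⟩
    obtain ⟨P, hPμ⟩ := hA.exists_isPrimitiveIdempotentFor hμ
    obtain ⟨i, rfl⟩ := (hE.2 P).2 ⟨μ, hPμ⟩
    have hi : μ = θ i := by
      by_contra hne
      exact h0 ((hPμ.2.1 v hv).symm.trans ((hP i).2.2 μ hne v hv))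
    subst hi
    rw [LinearMap.sum_apply, Finset.sum_eq_single i, hPμ.2.1 v hv, Module.End.one_apply]
    · intro j _ hji
      exact (hP j).2.2 (θ i) (fun h => hji (hinj h.symm)) v hv
    · simp
  · have : E i * A = θ i • E i := by
      refine hA.hom_ext fun μ w hw => ?_
      have hAw := Module.End.mem_eigenspace_iff.1 hw
      by_cases h : μ = θ i
      · simp [hAw, h]
      · simp [hAw, (hP i).2.2 μ h w hw]
    exact LinearMap.congr_fun this v

end Diagonalizable

/-! ### Functional calculus. -/

namespace IsSpectralResolution

variable {F V : Type*} [Field F] [AddCommGroup V] [Module F V] {d : ℕ}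
  {A : Module.End F V} {E : Fin (d + 1) → Module.End F V} {θ : Fin (d + 1) → F}

lemma sum_apply (h : IsSpectralResolution A E θ) (v : V) : ∑ i, E i v = v := by
  simpa using LinearMap.congr_fun h.sum_eq_one v

lemma eq_of_forall_apply_eq (h : IsSpectralResolution A E θ) {v w : V}
    (hvw : ∀ i, E i v = E i w) : v = w := by
  rw [← h.sum_apply v, ← h.sum_apply w]
  exact Finset.sum_congr rfl fun i _ => hvw i

lemma apply_aeval (h : IsSpectralResolution A E θ) (p : F[X]) (i : Fin (d + 1)) (v : V) :
    E i (aeval A p v) = p.eval (θ i) • E i v := by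
  induction p using Polynomial.induction_on generalizing v with
  | C a => simp [Algebra.algebraMap_eq_smul_one]
  | add p q hp hq => simp [hp, hq, add_smul]
  | monomial n a hn =>
    rw [pow_succ, ← mul_assoc, map_mul, Module.End.mul_apply, hn]
    simp [h.apply_map, smul_smul]

lemma aeval_apply (h : IsSpectralResolution A E θ) (p : F[X]) (i : Fin (d + 1)) (v : V) :
    aeval A p (E i v) = p.eval (θ i) • E i v := by
  refine h.eq_of_forall_apply_eq fun j => ?_
  rw [h.apply_aeval, map_smul]
  by_cases hij : j = i
  · rw [hij]
  · simp [h.apply_of_ne j i v hij]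

lemma aeval_eq_smul (h : IsSpectralResolution A E θ) {p : F[X]} {i : Fin (d + 1)}
    (hp : ∀ j ≠ i, p.eval (θ j) = 0) : aeval A p = p.eval (θ i) • E i := by
  ext v
  refine h.eq_of_forall_apply_eq fun j => ?_
  rw [h.apply_aeval, LinearMap.smul_apply, map_smul]
  by_cases hij : j = i
  · rw [hij, h.apply_self]
  · simp [hp j hij, h.apply_of_ne j i v hij]

/-- E_i is the Lagrange basis polynomial at θ_i evaluated at A. -/
lemma apply_mem_of_invariant (h : IsSpectralResolution A E θ) {W : Submodule F V}
    (hW : ∀ v ∈ W, A v ∈ W) (i : Fin (d + 1)) {v : V} (hv : v ∈ W) : E i v ∈ W := by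
  have haeval : ∀ p : F[X], ∀ v ∈ W, aeval A p v ∈ W := by
    intro p
    induction p using Polynomial.induction_on with
    | C a => intro v hv; simpa [Algebra.algebraMap_eq_smul_one] using W.smul_mem a hv
    | add p q hp hq => intro v hv; simpa using W.add_mem (hp v hv) (hq v hv)
    | monomial n a hn =>
      intro v hv
      rw [pow_succ, ← mul_assoc, map_mul, Module.End.mul_apply]
      exact hn _ (by simpa using hW v hv)
  have hE := h.aeval_eq_smul (p := Lagrange.basis Finset.univ θ i) (i := i) fun j hj =>
    Lagrange.eval_basis_of_ne hj.symm (Finset.mem_univ _)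
  rw [Lagrange.eval_basis_self h.injective.injOn (Finset.mem_univ _), one_smul] at hE
  exact hE ▸ haeval _ v hv

end IsSpectralResolution

/-! ### Flags of a spectral resolution and tridiagonal action on them. -/

/-- Vectors whose components `E i v` vanish for `i ≥ n`. -/
def lowerFiltration {F V : Type*} [Field F] [AddCommGroup V] [Module F V] {d : ℕ}
    (E : Fin (d + 1) → Module.End F V) (n : ℕ) : Submodule F V :=
  ⨅ (i : Fin (d + 1)) (_ : n ≤ i), LinearMap.ker (E i)

/-- Vectors whose components `E i v` vanish for `i < n`. -/
def upperFiltration {F V : Type*} [Field F] [AddCommGroup V] [Module F V] {d : ℕ}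
    (E : Fin (d + 1) → Module.End F V) (n : ℕ) : Submodule F V :=
  ⨅ (i : Fin (d + 1)) (_ : (i : ℕ) < n), LinearMap.ker (E i)

section Filtration

variable {F V : Type*} [Field F] [AddCommGroup V] [Module F V] {d : ℕ}
  {A : Module.End F V} {E : Fin (d + 1) → Module.End F V} {θ : Fin (d + 1) → F}
  {B : Module.End F V}

lemma mem_lowerFiltration {n : ℕ} {v : V} :
    v ∈ lowerFiltration E n ↔ ∀ i : Fin (d + 1), n ≤ i → E i v = 0 := by
  simp [lowerFiltration]

lemma mem_upperFiltration {n : ℕ} {v : V} :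
    v ∈ upperFiltration E n ↔ ∀ i : Fin (d + 1), (i : ℕ) < n → E i v = 0 := by
  simp [upperFiltration]

lemma lowerFiltration_mono {m n : ℕ} (h : m ≤ n) :
    lowerFiltration E m ≤ lowerFiltration E n := fun _ hv =>
  mem_lowerFiltration.2 fun i hi => mem_lowerFiltration.1 hv i (h.trans hi)

/-- A map acting tridiagonally raises the lower filtration by at most one. -/
lemma IsSpectralResolution.map_mem_lowerFiltration (h : IsSpectralResolution A E θ)
    (hB : ∀ i j : Fin (d + 1), 1 < |(i : ℤ) - (j : ℤ)| → E i * B * E j = 0)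
    {n : ℕ} {v : V} (hv : v ∈ lowerFiltration E n) : B v ∈ lowerFiltration E (n + 1) := by
  refine mem_lowerFiltration.2 fun i hi => ?_
  rw [← h.sum_apply v, map_sum, map_sum]
  refine Finset.sum_eq_zero fun j _ => ?_
  by_cases hj : n ≤ j
  · rw [mem_lowerFiltration.1 hv j hj]; simp
  · refine LinearMap.congr_fun (hB i j ?_) v
    rw [lt_abs]; left; omega

/-- A map acting tridiagonally lowers the upper filtration by at most one. -/
lemma IsSpectralResolution.map_mem_upperFiltration (h : IsSpectralResolution A E θ)
    (hB : ∀ i j : Fin (d + 1), 1 < |(i : ℤ) - (j : ℤ)| → E i * B * E j = 0)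
    {n : ℕ} {v : V} (hv : v ∈ upperFiltration E (n + 1)) : B v ∈ upperFiltration E n := by
  refine mem_upperFiltration.2 fun i hi => ?_
  rw [← h.sum_apply v, map_sum, map_sum]
  refine Finset.sum_eq_zero fun j _ => ?_
  by_cases hj : (j : ℕ) < n + 1
  · rw [mem_upperFiltration.1 hv j hj]; simp
  · refine LinearMap.congr_fun (hB i j ?_) v
    rw [lt_abs]; right; omega

lemma IsSpectralResolution.self_mem_lowerFiltration (h : IsSpectralResolution A E θ)
    {n : ℕ} {v : V} (hv : v ∈ lowerFiltration E n) : A v ∈ lowerFiltration E n := by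
  refine mem_lowerFiltration.2 fun i hi => ?_
  rw [h.apply_map, mem_lowerFiltration.1 hv i hi, smul_zero]

lemma IsSpectralResolution.sub_smul_mem_lowerFiltration (h : IsSpectralResolution A E θ)
    {n : ℕ} (hn : n < d + 1) {v : V} (hv : v ∈ lowerFiltration E (n + 1)) :
    A v - θ ⟨n, hn⟩ • v ∈ lowerFiltration E n := by
  refine mem_lowerFiltration.2 fun i hi => ?_
  rw [map_sub, map_smul, h.apply_map]
  rcases hi.eq_or_lt with hi | hi
  · rw [show i = ⟨n, hn⟩ from Fin.ext hi.symm, sub_self]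
  · rw [mem_lowerFiltration.1 hv i hi]; simp

lemma IsSpectralResolution.exists_sub_smul_mem_lowerFiltration
    (h : IsSpectralResolution A E θ) {n : ℕ} {v : V} (hv : v ∈ lowerFiltration E (n + 1)) :
    ∃ c : F, A v - c • v ∈ lowerFiltration E n := by
  by_cases hn : n < d + 1
  · exact ⟨_, h.sub_smul_mem_lowerFiltration hn hv⟩
  -- For n > d the filtration is the whole space and any scalar works.
  · exact ⟨0, mem_lowerFiltration.2 fun i hi => absurd i.isLt (by omega)⟩

lemma IsSpectralResolution.exists_sub_smul_mem_upperFiltration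
    (h : IsSpectralResolution A E θ) {n : ℕ} {v : V} (hv : v ∈ upperFiltration E n) :
    ∃ c : F, A v - c • v ∈ upperFiltration E (n + 1) := by
  have key : ∀ c : F, (∀ i : Fin (d + 1), (i : ℕ) = n → θ i = c) →
      A v - c • v ∈ upperFiltration E (n + 1) := fun c hc => by
    refine mem_upperFiltration.2 fun i hi => ?_
    rw [map_sub, map_smul, h.apply_map]
    rcases (Nat.lt_succ_iff.1 hi).eq_or_lt with hi | hi
    · rw [hc i hi, sub_self]
    · rw [mem_upperFiltration.1 hv i hi]; simp
  by_cases hn : n < d + 1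
  · exact ⟨θ ⟨n, hn⟩, key _ fun i hi => congrArg θ (Fin.ext hi)⟩
  · exact ⟨0, key _ fun i hi => absurd i.isLt (by omega)⟩

lemma IsSpectralResolution.aeval_mem_lowerFiltration (h : IsSpectralResolution A E θ)
    (hB : ∀ i j : Fin (d + 1), 1 < |(i : ℤ) - (j : ℤ)| → E i * B * E j = 0)
    {m n : ℕ} {p : F[X]} (hp : p.natDegree ≤ m) {v : V} (hv : v ∈ lowerFiltration E n) :
    aeval B p v ∈ lowerFiltration E (n + m) := by
  have hpow : ∀ k : ℕ, (B ^ k) v ∈ lowerFiltration E (n + k) := by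
    intro k
    induction k with
    | zero => simpa using hv
    | succ k ih =>
      rw [pow_succ', Module.End.mul_apply, ← add_assoc]
      exact h.map_mem_lowerFiltration hB ih
  rw [aeval_eq_sum_range, LinearMap.sum_apply]
  refine Submodule.sum_mem _ fun k hk => ?_
  rw [LinearMap.smul_apply]
  refine Submodule.smul_mem _ _ (lowerFiltration_mono ?_ (hpow k))
  have := Finset.mem_range.1 hk
  omega

end Filtration

/-! ### The polynomials τ_i and η_i. -/

section Polynomial

variable {F : Type*} [Field F] {d : ℕ}

lemma etaPoly_rev (θ : Fin (d + 1) → F) (i : Fin (d + 1)) :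
    etaPoly θ (Fin.rev i) = ∏ j ∈ Finset.Ioi i, (X - C (θ j)) := by
  unfold etaPoly
  refine Finset.prod_bij' (fun j _ => Fin.rev j) (fun j _ => Fin.rev j) ?_ ?_ ?_ ?_ ?_
  · intro j hj
    simpa [Fin.lt_rev_iff] using Finset.mem_Iio.1 hj
  · intro j hj
    simpa using hj
  all_goals simp

lemma natDegree_tauPoly (θ : Fin (d + 1) → F) (i : Fin (d + 1)) :
    (tauPoly θ i).natDegree = i := by
  rw [tauPoly, natDegree_prod_of_monic _ _ fun j _ => monic_X_sub_C (θ j)]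
  simp

lemma monic_tauPoly (θ : Fin (d + 1) → F) (i : Fin (d + 1)) : (tauPoly θ i).Monic :=
  monic_prod_of_monic _ _ fun j _ => monic_X_sub_C (θ j)

lemma eval_tauPoly_eq_zero (θ : Fin (d + 1) → F) {i j : Fin (d + 1)} (h : j < i) :
    (tauPoly θ i).eval (θ j) = 0 := by
  rw [tauPoly, eval_prod]
  exact Finset.prod_eq_zero (Finset.mem_Iio.2 h) (by simp)

lemma eval_tauPoly_ne_zero {θ : Fin (d + 1) → F} (hθ : Function.Injective θ)
    {i j : Fin (d + 1)} (h : i ≤ j) : (tauPoly θ i).eval (θ j) ≠ 0 := by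
  rw [tauPoly, eval_prod]
  refine Finset.prod_ne_zero_iff.2 fun k hk => ?_
  have hk := Finset.mem_Iio.1 hk
  simpa [sub_eq_zero] using fun hjk => (hk.trans_le h).ne' (hθ hjk)

/-- Expansion of `η_d` in the basis `τ_0, ..., τ_d`. -/
lemma etaPoly_last_eq_sum (θ : Fin (d + 1) → F) :
    etaPoly θ (Fin.last d) =
      ∑ i, C ((etaPoly θ (Fin.rev i)).eval (θ 0)) * tauPoly θ i := by
  -- Write X - θ_j = (θ_0 - θ_j) + (X - θ_0) and expand, sorting terms by the last index i at which
  -- X - θ_0 is chosen: the factors below i recombine into τ_i, and those above give η_{d-i}(θ_0).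
  have h := Finset.prod_add_ordered (Finset.Ioi (0 : Fin (d + 1)))
    (fun j => (C (θ 0 - θ j) : F[X])) (fun _ => X - C (θ 0))
  rw [← Fin.rev_zero, etaPoly_rev, Fintype.sum_eq_add_sum_compl 0]
  simp only [etaPoly_rev, eval_prod, eval_sub, eval_X, eval_C, map_prod]
  have hcompl : ({0}ᶜ : Finset (Fin (d + 1))) = Finset.Ioi 0 := by
    ext i; simp
  rw [hcompl]
  have hτ : tauPoly θ 0 = 1 := by
    rw [tauPoly]
    exact Finset.prod_eq_one fun j hj => absurd (Finset.mem_Iio.1 hj) (Fin.not_lt_zero j)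
  rw [hτ, mul_one]
  have hsum : ∀ j, (C (θ 0 - θ j) + (X - C (θ 0)) : F[X]) = X - C (θ j) := fun j => by
    rw [C_sub]; ring
  simp only [hsum] at h
  rw [h]
  simp only [C_sub]
  refine congrArg (_ + ·) (Finset.sum_congr rfl fun i hi => ?_)
  have hi := Finset.mem_Ioi.1 hi
  have h1 : (Finset.Ioi (0 : Fin (d + 1))).filter (i < ·) = Finset.Ioi i := by
    ext j
    simp only [Finset.mem_filter, Finset.mem_Ioi]
    exact ⟨fun h => h.2, fun h => ⟨hi.trans h, h⟩⟩
  have h2 : Finset.Iio i = insert 0 ((Finset.Ioi (0 : Fin (d + 1))).filter (· < i)) := by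
    ext j
    simp only [Finset.mem_insert, Finset.mem_filter, Finset.mem_Ioi, Finset.mem_Iio]
    constructor
    · intro h
      rcases eq_or_ne j 0 with h0 | h0
      · exact Or.inl h0
      · exact Or.inr ⟨Fin.pos_iff_ne_zero.2 h0, h⟩
    · rintro (rfl | h)
      · exact hi
      · exact h.2
  rw [h1, tauPoly, h2, Finset.prod_insert (by simp), mul_comm (∏ j ∈ Finset.Ioi i, _)]

end Polynomial

/-! ### Nonvanishing of top components, and the commutator identity. -/

namespace MTDSystem

variable {F V : Type*} [Field F] [AddCommGroup V] [Module F V] {d : ℕ}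
  (Φ : MTDSystem F V d) {θ θs ζ : Fin (d + 1) → F}

lemma exists_generator (hΦ : Φ.IsSharp) (hs : IsSpectralResolution Φ.As Φ.Es θs) :
    ∃ u : V, u ≠ 0 ∧ Φ.Es 0 u = u ∧ ∀ v, ∃ c : F, Φ.Es 0 v = c • u := by
  obtain ⟨⟨u, w, rfl⟩, hu, h⟩ := finrank_eq_one_iff'.1 (show Module.finrank F _ = 1 from hΦ)
  refine ⟨Φ.Es 0 w, fun h0 => hu (Subtype.ext h0), hs.apply_self 0 w, fun v => ?_⟩
  obtain ⟨c, hc⟩ := h ⟨Φ.Es 0 v, v, rfl⟩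
  exact ⟨c, (congrArg Subtype.val hc).symm⟩

/-- An `As`-invariant subspace on which `E 0` vanishes does not contain `E d u`. -/
lemma notMem_of_invariant (hs : IsSpectralResolution Φ.As Φ.Es θs) {u : V}
    (hspan : ∀ v, ∃ c : F, Φ.Es 0 v = c • u) {W : Submodule F V} (hAs : ∀ v ∈ W, Φ.As v ∈ W)
    (hW : ∀ v ∈ W, Φ.E 0 v = 0) : Φ.E (Fin.last d) u ∉ W := by
  intro hmem
  obtain ⟨c, hc⟩ := hspan (Φ.E (Fin.last d) u)
  have hc0 : c ≠ 0 := by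
    rintro rfl
    refine Φ.last_ne_zero (LinearMap.ext fun v => ?_)
    obtain ⟨a, ha⟩ := hspan v
    simp [ha, hc]
  have huW : u ∈ W := by
    have := hs.apply_mem_of_invariant hAs 0 hmem
    rw [hc] at this
    exact (W.smul_mem_iff hc0).1 this
  refine Φ.first_ne_zero (LinearMap.ext fun v => ?_)
  obtain ⟨a, ha⟩ := hspan v
  simp [ha, hW u huW]

/-- If the component vanished, τ_n(A)u would lie in (E_nV + ⋯ + E_dV) ∩ (E*_0V + ⋯ + E*_{n-1}V). The
sum W of these intersections over all n is invariant under A and A* and killed by E_0. Applying E_d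
puts E_d u in W, which `notMem_of_invariant` forbids. -/
lemma Es_tauPoly_ne_zero (hs : IsSpectralResolution Φ.As Φ.Es θs)
    (h : IsSpectralResolution Φ.A Φ.E θ) {u : V} (hu : Φ.Es 0 u = u)
    (hspan : ∀ v, ∃ c : F, Φ.Es 0 v = c • u) (n : Fin (d + 1)) :
    Φ.Es n (aeval Φ.A (tauPoly θ n) u) ≠ 0 := by
  intro h0
  set S : ℕ → Submodule F V := fun n => upperFiltration Φ.E n ⊓ lowerFiltration Φ.Es n with hS
  have hSW : ∀ n, S n ≤ ⨆ n, S n := le_iSup S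
  have hzero : ∀ v ∈ S 0, v = 0 := fun v hv => hs.eq_of_forall_apply_eq fun i => by
    rw [map_zero]; exact mem_lowerFiltration.1 hv.2 i (Nat.zero_le _)
  have hA : ∀ v ∈ ⨆ n, S n, Φ.A v ∈ ⨆ n, S n := by
    suffices (⨆ n, S n) ≤ (⨆ n, S n).comap Φ.A from fun v hv => this hv
    refine iSup_le fun m v hv => ?_
    -- A - c moves S m into S (m + 1); dually, A* - c moves S (m + 1) into S m.
    obtain ⟨c, hc⟩ := h.exists_sub_smul_mem_upperFiltration hv.1
    have h1 : Φ.A v - c • v ∈ S (m + 1) := ⟨hc, Submodule.sub_mem _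
      (hs.map_mem_lowerFiltration Φ.tridiag_star hv.2)
      (Submodule.smul_mem _ _ (lowerFiltration_mono m.le_succ hv.2))⟩
    have := Submodule.add_mem _ (hSW _ h1) (Submodule.smul_mem _ c (hSW _ hv))
    simpa using this
  have hAs : ∀ v ∈ ⨆ n, S n, Φ.As v ∈ ⨆ n, S n := by
    suffices (⨆ n, S n) ≤ (⨆ n, S n).comap Φ.As from fun v hv => this hv
    refine iSup_le fun m v hv => ?_
    rcases m with _ | m
    · rw [hzero v hv]; simp
    obtain ⟨c, hc⟩ := hs.exists_sub_smul_mem_lowerFiltration hv.2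
    have h1 : Φ.As v - c • v ∈ S m := ⟨Submodule.sub_mem _
      (h.map_mem_upperFiltration Φ.tridiag hv.1)
      (Submodule.smul_mem _ _ (mem_upperFiltration.2 fun i hi =>
        mem_upperFiltration.1 hv.1 i (by omega))), hc⟩
    have := Submodule.add_mem _ (hSW _ h1) (Submodule.smul_mem _ c (hSW _ hv))
    simpa using this
  have hW : ∀ v ∈ ⨆ n, S n, Φ.E 0 v = 0 := by
    suffices (⨆ n, S n) ≤ LinearMap.ker (Φ.E 0) from fun v hv => this hv
    refine iSup_le fun m v hv => ?_
    rcases m with _ | m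
    · rw [hzero v hv]; simp
    · exact mem_upperFiltration.1 hv.1 0 (by simp)
  refine Φ.notMem_of_invariant hs hspan hAs hW ?_
  have hu1 : u ∈ lowerFiltration Φ.Es 1 := mem_lowerFiltration.2 fun i hi => by
    rw [← hu]; exact hs.apply_of_ne i 0 u (by rintro rfl; simp at hi)
  have hmem : aeval Φ.A (tauPoly θ n) u ∈ S n := by
    refine ⟨mem_upperFiltration.2 fun i hi => ?_, mem_lowerFiltration.2 fun i hi => ?_⟩
    · rw [h.apply_aeval, eval_tauPoly_eq_zero θ (by exact hi), zero_smul]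
    · rcases hi.eq_or_lt with hi | hi
      · rw [← Fin.ext hi]; exact h0
      · exact mem_lowerFiltration.1 (hs.aeval_mem_lowerFiltration Φ.tridiag_star
          (natDegree_tauPoly θ n).le hu1) i (by omega)
  have := h.apply_mem_of_invariant hA (Fin.last d) (hSW _ hmem)
  rw [h.apply_aeval] at this
  exact (Submodule.smul_mem_iff _ (eval_tauPoly_ne_zero h.injective (Fin.le_last n))).1 this

/-- The top component of `p(A) u` depends only on the leading coefficient of `p`. -/
lemma Es_aeval_eq (hs : IsSpectralResolution Φ.As Φ.Es θs) {u : V} (hu : Φ.Es 0 u = u)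
    (n : Fin (d + 1)) {p : F[X]} (hp : p.natDegree ≤ n) :
    Φ.Es n (aeval Φ.A p u) = p.coeff n • Φ.Es n (aeval Φ.A (tauPoly θ n) u) := by
  have hu1 : u ∈ lowerFiltration Φ.Es 1 := mem_lowerFiltration.2 fun i hi => by
    rw [← hu]; exact hs.apply_of_ne i 0 u (by rintro rfl; simp at hi)
  have hτ : (tauPoly θ n).coeff n = 1 := by
    have := monic_tauPoly θ n
    rwa [Monic, leadingCoeff, natDegree_tauPoly] at this
  -- Cancelling the degree-n term leaves degree below n, which cannot reach the n-th component from
  -- u.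
  set q := p - C (p.coeff n) * tauPoly θ n with hq
  have hqd : q.natDegree ≤ n := (natDegree_sub_le _ _).trans
    (max_le hp ((natDegree_C_mul_le _ _).trans (natDegree_tauPoly θ n).le))
  have hqn : q.coeff n = 0 := by simp [hq, hτ]
  have hz : Φ.Es n (aeval Φ.A q u) = 0 := by
    by_cases hq0 : q = 0
    · simp [hq0]
    have hlt : q.natDegree < n := lt_of_le_of_ne hqd fun he => hq0 <| by
      rw [← leadingCoeff_eq_zero, leadingCoeff, he, hqn]
    exact mem_lowerFiltration.1 (hs.aeval_mem_lowerFiltration Φ.tridiag_star le_rfl hu1) n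
      (by omega)
  rw [hq, map_sub, map_mul, LinearMap.sub_apply, map_sub, sub_eq_zero] at hz
  rw [hz]
  simp

/-- Interpolating the differences `θ_i θ_{i+1} (θ_i - θ_{i+1})` gives a polynomial `p` with
`A² As A - A As A² = [p(A), As]`. -/
lemma exists_commutator_polynomial (h : IsSpectralResolution Φ.A Φ.E θ) :
    ∃ p : F[X], p.natDegree ≤ d ∧
      (∀ i j : Fin (d + 1), (j : ℕ) = i + 1 →
        p.eval (θ i) - p.eval (θ j) = θ i * θ j * (θ i - θ j)) ∧
      ∀ v, Φ.A (Φ.A (Φ.As (Φ.A v))) - Φ.A (Φ.As (Φ.A (Φ.A v))) =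
        aeval Φ.A p (Φ.As v) - Φ.As (aeval Φ.A p v) := by
  set t : ℕ → F := fun k => if hk : k < d + 1 then θ ⟨k, hk⟩ else 0 with ht
  have htθ : ∀ i : Fin (d + 1), t i = θ i := fun i => dif_pos i.isLt
  -- Partial sums, so that consecutive differences are the prescribed ones; only t 0, ..., t i
  -- occur, so the default value 0 of t never enters.
  set z : Fin (d + 1) → F := fun i =>
    -∑ k ∈ Finset.range i, t k * t (k + 1) * (t k - t (k + 1)) with hz
  have hinj : Set.InjOn θ (Finset.univ : Finset (Fin (d + 1))) := h.injective.injOn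
  set p := Lagrange.interpolate Finset.univ θ z with hp
  have hpe : ∀ i, p.eval (θ i) = z i := fun i =>
    Lagrange.eval_interpolate_at_node z hinj (Finset.mem_univ i)
  have hdiff : ∀ i j : Fin (d + 1), (j : ℕ) = i + 1 →
      p.eval (θ i) - p.eval (θ j) = θ i * θ j * (θ i - θ j) := by
    intro i j hij
    rw [hpe, hpe, ← htθ i, ← htθ j, hz]
    simp only [hij, Finset.sum_range_succ]
    ring
  refine ⟨p, ?_, hdiff, fun v => ?_⟩
  · have := Lagrange.degree_interpolate_lt z hinj
    rw [Finset.card_univ, Fintype.card_fin] at this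
    exact natDegree_le_of_degree_le (Order.le_of_lt_succ this)
  -- Compare (i, j) blocks: the two sides scale E_i A* E_j by θ_iθ_j(θ_i - θ_j) and p(θ_i) - p(θ_j),
  -- and only |i - j| ≤ 1 matters.
  · refine h.eq_of_forall_apply_eq fun i => ?_
    rw [← h.sum_apply v]
    simp only [map_sum, ← Finset.sum_sub_distrib]
    refine Finset.sum_congr rfl fun j _ => ?_
    simp only [map_sub, map_smul, h.apply_map, h.map_apply, h.apply_aeval, h.aeval_apply,
      smul_smul, ← sub_smul]
    by_cases hij : 1 < |(i : ℤ) - (j : ℤ)|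
    · have : Φ.E i (Φ.As (Φ.E j v)) = 0 := LinearMap.congr_fun (Φ.tridiag i j hij) v
      rw [this, smul_zero, smul_zero]
    · congr 1
      rw [not_lt, abs_le] at hij
      have h3 : (i : ℕ) = j ∨ (j : ℕ) = i + 1 ∨ (i : ℕ) = j + 1 := by omega
      rcases h3 with h3 | h3 | h3
      · rw [Fin.ext h3]; ring
      · rw [hdiff i j h3]; ring
      · rw [← neg_sub (p.eval (θ j)), hdiff j i h3]; ring

end MTDSystem

/-! ### The cubic recurrence. -/

namespace MTDSystem

variable {F V : Type*} [Field F] [AddCommGroup V] [Module F V] {d : ℕ}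
  (Φ : MTDSystem F V d) {θ θs ζ : Fin (d + 1) → F}

/-- The commutator `[p(A), As]` on the lower filtration, in the top component that `p(A)` can
reach. -/
lemma Es_commutator_eq (hs : IsSpectralResolution Φ.As Φ.Es θs)
    {p : F[X]} {v : V} {m : ℕ} (hm : m < d + 1) {n : Fin (d + 1)} (hn : m + p.natDegree ≤ n)
    (hv : v ∈ lowerFiltration Φ.Es (m + 1)) :
    Φ.Es n (aeval Φ.A p (Φ.As v) - Φ.As (aeval Φ.A p v)) =
      (θs ⟨m, hm⟩ - θs n) • Φ.Es n (aeval Φ.A p v) := by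
  have h1 := hs.aeval_mem_lowerFiltration Φ.tridiag_star (le_refl p.natDegree)
    (hs.sub_smul_mem_lowerFiltration hm hv)
  have h2 := mem_lowerFiltration.1 h1 n hn
  rw [map_sub, map_sub, map_smul, map_smul, sub_eq_zero] at h2
  rw [map_sub, h2, hs.apply_map, sub_smul]

/-- The polynomial `p` with `A² As A - A As A² = [p(A), As]` is at most cubic, and its cubic
coefficient governs the recurrence of the dual eigenvalues. -/
lemma exists_cubic_recurrence (hΦ : Φ.IsSharp) (hs : IsSpectralResolution Φ.As Φ.Es θs)
    (h : IsSpectralResolution Φ.A Φ.E θ) :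
    ∃ p : F[X], p.natDegree ≤ 3 ∧
      (∀ i j : Fin (d + 1), (j : ℕ) = i + 1 →
        p.eval (θ i) - p.eval (θ j) = θ i * θ j * (θ i - θ j)) ∧
      ∀ (m : ℕ) (hm : m + 3 < d + 1),
        p.coeff 3 * (θs ⟨m, by omega⟩ - θs ⟨m + 3, hm⟩) =
          θs ⟨m + 1, by omega⟩ - θs ⟨m + 2, by omega⟩ := by
  obtain ⟨u, -, hu, hspan⟩ := Φ.exists_generator hΦ hs
  obtain ⟨p, hpd, hpθ, hcomm⟩ := Φ.exists_commutator_polynomial h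
  have hu1 : u ∈ lowerFiltration Φ.Es (0 + 1) := mem_lowerFiltration.2 fun i hi => by
    rw [← hu]; exact hs.apply_of_ne i 0 u (by rintro rfl; simp at hi)
  have hraise : ∀ {n : ℕ} {v : V}, v ∈ lowerFiltration Φ.Es n →
      Φ.A v ∈ lowerFiltration Φ.Es (n + 1) :=
    fun hv => hs.map_mem_lowerFiltration Φ.tridiag_star hv
  have hp3 : p.natDegree ≤ 3 := by
    -- At n = deg p > 3 the left side of the commutator identity on u has no component, while the
    -- right side has a nonzero one.
    by_contra! hlt
    set n : Fin (d + 1) := ⟨p.natDegree, by omega⟩ with hn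
    have h1 := Φ.Es_commutator_eq hs (p := p) (m := 0) (by omega) (n := n) (Nat.zero_add _).le hu1
    have h2 : Φ.A (Φ.A (Φ.As (Φ.A u))) - Φ.A (Φ.As (Φ.A (Φ.A u))) ∈
        lowerFiltration Φ.Es 4 := Submodule.sub_mem _
      (hraise (hraise (hs.self_mem_lowerFiltration (hraise hu1))))
      (hraise (hs.self_mem_lowerFiltration (hraise (hraise hu1))))
    rw [← hcomm, mem_lowerFiltration.1 h2 n hlt, Φ.Es_aeval_eq (θ := θ) hs hu n le_rfl] at h1
    have h3 : θs ⟨0, by omega⟩ - θs n ≠ 0 := by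
      rw [sub_ne_zero]
      intro he
      have := congrArg Fin.val (hs.injective he)
      simp only [hn] at this
      omega
    have h4 : p.coeff n ≠ 0 := by
      change p.leadingCoeff ≠ 0
      rw [leadingCoeff_ne_zero]
      rintro rfl
      simp at hlt
    exact smul_ne_zero h3 (smul_ne_zero h4 (Φ.Es_tauPoly_ne_zero hs h hu hspan n)) h1.symm
  refine ⟨p, hp3, hpθ, fun m hm => ?_⟩
  set n : Fin (d + 1) := ⟨m + 3, hm⟩ with hn
  -- The coefficient of X^(m+3) in q X^m is the cubic coefficient of q.
  have htop : ∀ q : F[X], q.natDegree ≤ 3 → Φ.Es n (aeval Φ.A q (aeval Φ.A (X ^ m) u)) =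
      q.coeff 3 • Φ.Es n (aeval Φ.A (tauPoly θ n) u) := fun q hq => by
    rw [← Module.End.mul_apply (aeval Φ.A q), ← map_mul, Φ.Es_aeval_eq (θ := θ) hs hu n, hn]
    · simp only [add_comm m 3, coeff_mul_X_pow]
    · refine natDegree_mul_le.trans ?_
      rw [natDegree_X_pow]
      simp only [hn]; omega
  set v : V := aeval Φ.A (X ^ m : F[X]) u with hv
  have hvm : v ∈ lowerFiltration Φ.Es (m + 1) := by
    have := hs.aeval_mem_lowerFiltration Φ.tridiag_star
      (natDegree_X_pow_le (R := F) m) hu1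
    exact lowerFiltration_mono (by omega) this
  have hA3 : Φ.Es n (Φ.A (Φ.A (Φ.A v))) = Φ.Es n (aeval Φ.A (tauPoly θ n) u) := by
    have := htop (X ^ 3) (natDegree_X_pow_le 3)
    simpa [pow_succ, hv] using this
  have hleft : Φ.Es n (Φ.A (Φ.A (Φ.As (Φ.A v)))) =
      θs ⟨m + 1, by omega⟩ • Φ.Es n (Φ.A (Φ.A (Φ.A v))) := by
    have h1 := hraise (hraise (hs.sub_smul_mem_lowerFiltration
      (n := m + 1) (by omega) (hraise hvm)))
    have h2 := mem_lowerFiltration.1 h1 n le_rfl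
    simpa only [map_sub, map_smul, sub_eq_zero] using h2
  have hright : Φ.Es n (Φ.A (Φ.As (Φ.A (Φ.A v)))) =
      θs ⟨m + 2, by omega⟩ • Φ.Es n (Φ.A (Φ.A (Φ.A v))) := by
    have h1 := hraise (hs.sub_smul_mem_lowerFiltration
      (n := m + 2) (by omega) (hraise (hraise hvm)))
    have h2 := mem_lowerFiltration.1 h1 n le_rfl
    simpa only [map_sub, map_smul, sub_eq_zero] using h2
  have h1 := Φ.Es_commutator_eq hs (p := p) (m := m) (by omega) (n := n)
    (Nat.add_le_add_left hp3 m) hvm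
  rw [← hcomm, map_sub, hleft, hright, hA3, htop p hp3, ← sub_smul, smul_smul] at h1
  rw [mul_comm]
  exact (smul_left_injective F (Φ.Es_tauPoly_ne_zero hs h hu hspan n) h1).symm

/-- The differences of a cubic at consecutive nodes determine a three-term recurrence. -/
lemma _root_.Polynomial.coeff_three_mul_sub {p : F[X]} (hp : p.natDegree ≤ 3) {x y z w : F}
    (hxy : x ≠ y) (hyz : y ≠ z) (hzw : z ≠ w) (hxz : x ≠ z) (hyw : y ≠ w)
    (h1 : p.eval x - p.eval y = x * y * (x - y)) (h2 : p.eval y - p.eval z = y * z * (y - z))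
    (h3 : p.eval z - p.eval w = z * w * (z - w)) : p.coeff 3 * (x - w) = y - z := by
  simp only [eval_eq_sum_range' (Nat.lt_succ_of_le hp), Finset.sum_range_succ,
    Finset.sum_range_zero] at h1 h2 h3
  set a := p.coeff 3
  set b := p.coeff 2
  set c := p.coeff 1
  -- Two rounds of divided differences: the first removes the constant term, the second the linear
  -- one.
  have k1 : a * (x ^ 2 + x * y + y ^ 2) + b * (x + y) + c = x * y :=
    mul_left_cancel₀ (sub_ne_zero.2 hxy) (by linear_combination h1)
  have k2 : a * (y ^ 2 + y * z + z ^ 2) + b * (y + z) + c = y * z :=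
    mul_left_cancel₀ (sub_ne_zero.2 hyz) (by linear_combination h2)
  have k3 : a * (z ^ 2 + z * w + w ^ 2) + b * (z + w) + c = z * w :=
    mul_left_cancel₀ (sub_ne_zero.2 hzw) (by linear_combination h3)
  have l1 : a * (x + y + z) + b = y :=
    mul_left_cancel₀ (sub_ne_zero.2 hxz) (by linear_combination k1 - k2)
  have l2 : a * (y + z + w) + b = z :=
    mul_left_cancel₀ (sub_ne_zero.2 hyw) (by linear_combination k2 - k3)
  linear_combination l1 - l2

/-! ### Conditions on the split sequence. -/

lemma Es_zero_ne_zero : Φ.Es 0 ≠ 0 := fun h => Φ.first_ne_zero (by simp [h])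

lemma Es_zero_mul_self (hs : IsSpectralResolution Φ.As Φ.Es θs) : Φ.Es 0 * Φ.Es 0 = Φ.Es 0 :=
  LinearMap.ext fun v => hs.apply_self 0 v

lemma splitSequence_zero (hs : IsSpectralResolution Φ.As Φ.Es θs)
    (hζ : Φ.IsSplitSequence θ θs ζ) : ζ 0 = 1 := by
  have h := hζ 0
  have hτ : tauPoly θ 0 = 1 := by
    rw [tauPoly]
    exact Finset.prod_eq_one fun j hj => absurd (Finset.mem_Iio.1 hj) (Fin.not_lt_zero j)
  rw [hτ, map_one, mul_one, Φ.Es_zero_mul_self hs, Finset.Ioc_self, Finset.prod_empty,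
    div_one] at h
  exact smul_left_injective F Φ.Es_zero_ne_zero (h.symm.trans (one_smul F _).symm)

/-- τ_d vanishes at every θ_j except θ_d, so τ_d(A) = τ_d(θ_d) E_d. -/
lemma splitSequence_last_ne_zero (h : IsSpectralResolution Φ.A Φ.E θ)
    (hζ : Φ.IsSplitSequence θ θs ζ) : ζ (Fin.last d) ≠ 0 := by
  intro h0
  have hd := hζ (Fin.last d)
  rw [h0, zero_div, zero_smul, h.aeval_eq_smul (i := Fin.last d) fun j hj =>
    eval_tauPoly_eq_zero θ (lt_of_le_of_ne (Fin.le_last j) hj), mul_smul_comm,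
    smul_mul_assoc] at hd
  exact smul_ne_zero (eval_tauPoly_ne_zero h.injective le_rfl) Φ.last_ne_zero hd

/-- Expanding η_d in the τ_i shows that the sum, divided by ∏_{k>0}(θ*_0 - θ*_k), is the scalar by
which E*_0 η_d(A) E*_0 multiplies E*_0. But η_d(A) = η_d(θ_0) E_0. -/
lemma sum_etaPoly_mul_splitSequence_ne_zero (hs : IsSpectralResolution Φ.As Φ.Es θs)
    (h : IsSpectralResolution Φ.A Φ.E θ) (hζ : Φ.IsSplitSequence θ θs ζ) :
    ∑ i : Fin (d + 1), (etaPoly θ (Fin.rev i)).eval (θ 0) *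
      (etaPoly θs (Fin.rev i)).eval (θs 0) * ζ i ≠ 0 := by
  intro h0
  have hne : ∀ i : Fin (d + 1), ∏ k ∈ Finset.Ioc 0 i, (θs 0 - θs k) ≠ 0 := fun i =>
    Finset.prod_ne_zero_iff.2 fun k hk =>
      sub_ne_zero.2 (hs.injective.ne (Finset.mem_Ioc.1 hk).1.ne)
  have hsplit : ∀ i : Fin (d + 1), (∏ k ∈ Finset.Ioc 0 i, (θs 0 - θs k)) *
      (etaPoly θs (Fin.rev i)).eval (θs 0) = ∏ k ∈ Finset.Ioi 0, (θs 0 - θs k) := fun i => by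
    rw [etaPoly_rev, eval_prod]
    simp only [eval_sub, eval_X, eval_C]
    rw [← Finset.prod_union]
    · congr 1
      ext k
      simp only [Finset.mem_union, Finset.mem_Ioc, Finset.mem_Ioi]
      constructor
      · rintro (hk | hk)
        · exact hk.1
        · exact (Fin.zero_le i).trans_lt hk
      · exact fun hk => (le_or_gt k i).imp (fun hki => ⟨hk, hki⟩) id
    · exact Finset.disjoint_left.2 fun k hk hk' =>
        (Finset.mem_Ioc.1 hk).2.not_gt (Finset.mem_Ioi.1 hk')
  have hzero : Φ.Es 0 * aeval Φ.A (etaPoly θ (Fin.last d)) * Φ.Es 0 = 0 := by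
    have hterm : ∀ i : Fin (d + 1), (∏ k ∈ Finset.Ioi 0, (θs 0 - θs k)) •
        (Φ.Es 0 * aeval Φ.A (C ((etaPoly θ (Fin.rev i)).eval (θ 0)) * tauPoly θ i) * Φ.Es 0) =
        ((etaPoly θ (Fin.rev i)).eval (θ 0) *
          (etaPoly θs (Fin.rev i)).eval (θs 0) * ζ i) • Φ.Es 0 := fun i => by
      rw [← smul_eq_C_mul, map_smul, mul_smul_comm, smul_mul_assoc, hζ i, smul_smul, smul_smul,
        ← hsplit i]
      congr 1
      field_simp [hne i]
    have hP : ∏ k ∈ Finset.Ioi (0 : Fin (d + 1)), (θs 0 - θs k) ≠ 0 :=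
      Finset.prod_ne_zero_iff.2 fun k hk =>
        sub_ne_zero.2 (hs.injective.ne (Finset.mem_Ioi.1 hk).ne)
    refine (smul_eq_zero.1 ?_).resolve_left hP
    rw [etaPoly_last_eq_sum, map_sum, Finset.mul_sum, Finset.sum_mul, Finset.smul_sum,
      Finset.sum_congr rfl fun i _ => hterm i, ← Finset.sum_smul, h0, zero_smul]
  have hev : ∀ x : F, (etaPoly θ (Fin.last d)).eval x = ∏ j ∈ Finset.Ioi 0, (x - θ j) :=
    fun x => by rw [← Fin.rev_zero, etaPoly_rev, eval_prod]; simp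
  rw [h.aeval_eq_smul (i := 0) fun j hj => (hev _).trans
      (Finset.prod_eq_zero (Finset.mem_Ioi.2 (Fin.pos_iff_ne_zero.2 hj)) (sub_self _)),
    mul_smul_comm, smul_mul_assoc, hev] at hzero
  refine smul_ne_zero (Finset.prod_ne_zero_iff.2 fun k hk => ?_) Φ.first_ne_zero hzero
  exact sub_ne_zero.2 (h.injective.ne (Finset.mem_Ioi.1 hk).ne)

end MTDSystem

/-! ### The main theorem. -/

theorem corollary3p9 {F V : Type*} [Field F] [AddCommGroup V] [Module F V]
    [FiniteDimensional F V] [Nontrivial V] {d : ℕ}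
    (Φ : MTDSystem F V d) (hΦ : Φ.IsSharp) (θ θs ζ : Fin (d + 1) → F)
    (hpar : Φ.IsParameterArray θ θs ζ) :
    (∀ i j : Fin (d + 1), i ≠ j → θ i ≠ θ j ∧ θs i ≠ θs j) ∧
    (ζ 0 = 1 ∧ ζ (Fin.last d) ≠ 0 ∧
      ∑ i : Fin (d + 1), (etaPoly θ (Fin.rev i)).eval (θ 0) *
        (etaPoly θs (Fin.rev i)).eval (θs 0) * ζ i ≠ 0) ∧
    (∃ β : F, ∀ (i : ℕ) (h2 : 2 ≤ i) (hd : i + 1 ≤ d),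
      (θ ⟨i - 2, by omega⟩ - θ ⟨i + 1, by omega⟩) /
        (θ ⟨i - 1, by omega⟩ - θ ⟨i, by omega⟩) = β ∧
      (θs ⟨i - 2, by omega⟩ - θs ⟨i + 1, by omega⟩) /
        (θs ⟨i - 1, by omega⟩ - θs ⟨i, by omega⟩) = β) := by
  obtain ⟨hθ, hθs, hζ⟩ := hpar
  have h := hθ.isSpectralResolution Φ.diag Φ.ordering
  have hs := hθs.isSpectralResolution Φ.diag_star Φ.ordering_star
  refine ⟨fun i j hij => ⟨h.injective.ne hij, hs.injective.ne hij⟩,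
    ⟨Φ.splitSequence_zero hs hζ, Φ.splitSequence_last_ne_zero h hζ,
      Φ.sum_etaPoly_mul_splitSequence_ne_zero hs h hζ⟩, ?_⟩
  obtain ⟨p, hp, hpθ, hrec⟩ := Φ.exists_cubic_recurrence hΦ hs h
  refine ⟨(p.coeff 3)⁻¹, fun i h2 hd => ?_⟩
  obtain ⟨m, rfl⟩ := Nat.exists_eq_add_of_le' h2
  have hne : ∀ {a b : ℕ} (ha : a < d + 1) (hb : b < d + 1), a ≠ b → θ ⟨a, ha⟩ ≠ θ ⟨b, hb⟩ :=
    fun ha hb hab => h.injective.ne fun he => hab (congrArg Fin.val he)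
  -- Both c and x are nonzero because their product is.
  have hdiv : ∀ {x y c : F}, c * x = y → y ≠ 0 → x / y = c⁻¹ := by
    rintro x y c rfl hy
    have hc := left_ne_zero_of_mul hy
    have hx := right_ne_zero_of_mul hy
    field_simp
  refine ⟨hdiv ?_ ?_, hdiv (hrec m (by omega)) ?_⟩
  · refine coeff_three_mul_sub hp (hne _ _ ?_) (hne _ _ ?_) (hne _ _ ?_) (hne _ _ ?_)
      (hne _ _ ?_) (hpθ _ _ ?_) (hpθ _ _ ?_) (hpθ _ _ ?_)
    all_goals grind
  · exact sub_ne_zero.2 (hne _ _ (by omega))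
  · exact sub_ne_zero.2 (hs.injective.ne fun he => by
      have := congrArg Fin.val he
      simp only at this
      omega)
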